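/- Let $p$ be a prime and let $G$ be a finite $p$-group with derived subgroup $G'$. Let $(G')^p$ be the subgroup generated by the $p$-th powers of the elements of $G'$, and let $d=\log_p|G':(G')^p|$. Suppose that $d\le p-1$ and that the action of $G$ on $G'$ is uniserial modulo $(G')^p$; that is, writing $\overline{G}=G/(G')^p$ and $N=G'/(G')^p$, and putting $N_0=N$ and $N_{i+1}=[N_i,\overline{G}]$ for $i\ge 0$, we have $|N_i:N_{i+1}|\le p$ for every $i\ge 0$. Then there exists $x\in G$ such that $G'=\{[x,g]\mid g\in G\}$. -/

import Mathlib

open scoped commutatorElement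

/-- The subgroup `H ^ n` of `G` generated by the `n`-th powers of the elements of `H`. -/
def powerSubgroup {G : Type*} [Group G] (H : Subgroup G) (n : ℕ) : Subgroup G :=
  Subgroup.closure ((fun h : G => h ^ n) '' (H : Set G))

/-- If `H` is normal in `G`, then so is `H ^ n`. -/
instance powerSubgroup_normal {G : Type*} [Group G] (H : Subgroup G) [hH : H.Normal] (n : ℕ) :
    (powerSubgroup H n).Normal := by
  have key : ∀ g : G, ∀ a ∈ (fun h : G => h ^ n) '' (H : Set G),
      g * a * g⁻¹ ∈ powerSubgroup H n := by
    rintro g _ ⟨h, hh, rfl⟩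
    refine Subgroup.subset_closure ⟨g * h * g⁻¹, hH.conj_mem h hh g, ?_⟩
    simp only [conj_pow]
  refine ⟨fun a ha g => ?_⟩
  have hle : powerSubgroup H n ≤ (powerSubgroup H n).comap (MulAut.conj g).toMonoidHom :=
    (Subgroup.closure_le _).2 fun b hb => key g b hb
  exact hle ha

/-- The subgroup `[N, G, ..., G]` with `G` occurring `i` times: it is `N` for `i = 0`, and
`[N, G, ..., G]` with `i + 1` copies of `G` is the commutator of `[N, G, ..., G]` (`i` copies)
with the whole group `G`. -/
def iteratedCommutator {G : Type*} [Group G] (N : Subgroup G) : ℕ → Subgroup G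
  | 0 => N
  | i + 1 => ⁅iteratedCommutator N i, (⊤ : Subgroup G)⁆

/-- For a finite `p`-group `G` and a normal subgroup `N`: the action of `G` on `N` is uniserial,
that is, `|[N, G, ..., G] : [N, G, ..., G]| ≤ p` with `i` and `i + 1` copies of `G`,
for every `i ≥ 0`. -/
def IsUniserialAction (p : ℕ) {G : Type*} [Group G] (N : Subgroup G) : Prop :=
  ∀ i : ℕ, (iteratedCommutator N (i + 1)).relIndex (iteratedCommutator N i) ≤ p

/-- For a finite `p`-group `G` and normal subgroups `M ≤ N`: the action of `G` on `N` is uniserial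
modulo `M`, that is, the action of `G / M` on `N / M` is uniserial. -/
def IsUniserialActionMod (p : ℕ) {G : Type*} [Group G] (N M : Subgroup G) [M.Normal] : Prop :=
  IsUniserialAction p (N.map (QuotientGroup.mk' M))

/-!
The proof works with a descending series `G = E 1 ≥ E 2 = G' ≥ E 3 ≥ ⋯` of normal subgroups in which
commutation with `G` moves down by one step and taking `p`-th powers moves down by `d` steps,
`E (j + 1) = [E j, G] (E (j + 1 - d)) ^ p`, where indices smaller than `2` are replaced by `2`.
By successive approximation along the series it suffices to find `x` such that every element of
`E j` is congruent to some `[x, g]` modulo `E (j + 1)`, for all `j ≥ 2`.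

The arithmetic of the series rests on one congruence, `mk_mul_pow_prime`, a form of the
Hall–Petrescu formula: `(c a) ^ p ≡ c ^ p a ^ p` up to `p`-th powers of commutators of `a` and `c`
and up to commutators of weight `p`. It is proved through polynomial sequences and Host–Kra cube
groups, where the collection process becomes the observation that commutators of functions
supported on faces of a cube are again such functions. As `d ≤ p - 1`, the congruence gives
`[E i, E j] ≤ E (i + j)` (`PotentSeries.commutator_le`), it shows that `p`-th powers induce
surjective homomorphisms `E j / E (j + 1) → E (j + d) / E (j + d + 1)` for `j ≥ 2`
(`PotentSeries.le_powerCosets`), and that `[x, h ^ p] ≡ [x, h] ^ p` modulo `E (j + d + 2)` for `h ∈ E j`, `j ≥ 2`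
(`PotentSeries.mk_commutator_pow`). Uniseriality makes the factors from `E 2` to
`E (d + 2) = (G') ^ p` cyclic of order at most `p`.

Since a `p`-group is not a union of `p` proper subgroups, there is an `x` outside all those of the
`d + 1 ≤ p` centralisers `C_G(E j / E (j + 2))`, `1 ≤ j ≤ d + 1`, that are proper. Then `[x, E j]`
covers `E (j + 1) / E (j + 2)` for `1 ≤ j ≤ d`, and, `p`-th powers being taken, also for all larger
`j` not congruent to `1` modulo `d`. If `C_G(E (d + 1) / E (d + 3))` is proper, the remaining
factors are covered in the same way. If it is all of `G`, commutators of weight `p` lie one step deeper than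
they need to, and `[x, g ^ p] ≡ [x, g] ^ p` holds for arbitrary `g ∈ G` at the remaining factors
(`PotentSeries.Reaches.add`).
-/

/-! ### Polynomial sequences and the Hall–Petrescu congruence -/

section CubeGroup

variable {H α : Type*} [Group H] [DecidableEq α]

/-- The function on the cube `Finset α` that equals `c` on the upper face `{T | S ⊆ T}` and `1`
elsewhere, as a homomorphism in `c`. -/
def upperFace (S : Finset α) : H →* (Finset α → H) where
  toFun c T := if S ⊆ T then c else 1
  map_one' := by ext T; simp
  map_mul' a b := by ext T; by_cases h : S ⊆ T <;> simp [h]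

lemma upperFace_apply (S T : Finset α) (c : H) :
    upperFace S c T = if S ⊆ T then c else 1 := rfl

lemma commutator_upperFace (S T : Finset α) (c e : H) :
    ⁅upperFace S c, upperFace T e⁆ = upperFace (S ∪ T) ⁅c, e⁆ := by
  ext U
  by_cases hS : S ⊆ U <;> by_cases hT : T ⊆ U <;>
    simp [commutatorElement_def, upperFace_apply, Finset.union_subset_iff, hS, hT]

/-- The Host–Kra cube group of the filtration `Γ`, restricted to a family `𝒰` of faces: it is
generated by the functions supported on an upper face `{T | S ⊆ T}`, `S ∈ 𝒰`, and constant there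
with value in `Γ |S|`. -/
def cubeGroup (Γ : ℕ → Subgroup H) (𝒰 : Finset (Finset α)) : Subgroup (Finset α → H) :=
  Subgroup.closure {f | ∃ S ∈ 𝒰, ∃ c ∈ Γ S.card, upperFace S c = f}

variable {Γ : ℕ → Subgroup H}

lemma upperFace_mem_cubeGroup {𝒰 : Finset (Finset α)} {S : Finset α} (hS : S ∈ 𝒰) {c : H}
    (hc : c ∈ Γ S.card) : upperFace S c ∈ cubeGroup Γ 𝒰 :=
  Subgroup.subset_closure ⟨S, hS, c, hc, rfl⟩

lemma apply_eq_one_of_mem_cubeGroup {𝒰 : Finset (Finset α)} {R : Finset α}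
    (hR : ∀ T ∈ 𝒰, ¬ T ⊆ R) {f : Finset α → H} (hf : f ∈ cubeGroup Γ 𝒰) : f R = 1 := by
  have : cubeGroup Γ 𝒰 ≤ (Pi.evalMonoidHom (fun _ : Finset α => H) R).ker := by
    refine (Subgroup.closure_le _).2 ?_
    rintro _ ⟨S, hS, c, -, rfl⟩
    simp [MonoidHom.mem_ker, upperFace_apply, hR S hS]
  exact this hf

/-- The cube group of an upper set of faces is normalised by all the face functions, since the
commutator of the faces of `S` and `T` is a face of `S ∪ T`. -/
lemma conj_upperFace_mem_cubeGroup (hanti : Antitone Γ)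
    (hcomm : ∀ s t, ⁅Γ s, Γ t⁆ ≤ Γ (s + t)) {𝒰 : Finset (Finset α)}
    (hup : ∀ S ∈ 𝒰, ∀ T, S ⊆ T → T ∈ 𝒰) (S : Finset α) {c : H} (hc : c ∈ Γ S.card)
    {f : Finset α → H} (hf : f ∈ cubeGroup Γ 𝒰) :
    upperFace S c * f * (upperFace S c)⁻¹ ∈ cubeGroup Γ 𝒰 := by
  have : cubeGroup Γ 𝒰 ≤ (cubeGroup Γ 𝒰).comap (MulAut.conj (upperFace S c)).toMonoidHom := by
    refine (Subgroup.closure_le _).2 ?_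
    rintro _ ⟨T, hT, e, he, rfl⟩
    have h1 : upperFace (S ∪ T) ⁅c, e⁆ ∈ cubeGroup Γ 𝒰 :=
      upperFace_mem_cubeGroup (hup T hT _ Finset.subset_union_right)
        (hanti (Finset.card_union_le S T)
          (hcomm _ _ (Subgroup.commutator_mem_commutator hc he)))
    have h2 := mul_mem h1 (upperFace_mem_cubeGroup hT he)
    rw [← commutator_upperFace, commutatorElement_def, inv_mul_cancel_right] at h2
    simpa using h2
  exact this hf

lemma exists_eq_upperFace_mul (hanti : Antitone Γ)
    (hcomm : ∀ s t, ⁅Γ s, Γ t⁆ ≤ Γ (s + t)) {𝒰 : Finset (Finset α)} {R : Finset α}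
    (hup' : ∀ S ∈ 𝒰.erase R, ∀ T, S ⊆ T → T ∈ 𝒰.erase R)
    {f : Finset α → H} (hf : f ∈ cubeGroup Γ 𝒰) :
    ∃ c ∈ Γ R.card, ∃ u ∈ cubeGroup Γ (𝒰.erase R), f = upperFace R c * u := by
  have hconj := fun {c : H} (hc : c ∈ Γ R.card) {u : Finset α → H} hu =>
    conj_upperFace_mem_cubeGroup (f := u) hanti hcomm hup' R hc hu
  induction hf using Subgroup.closure_induction with
  | mem f hf =>
    obtain ⟨S, hS, c, hc, rfl⟩ := hf
    by_cases hSR : S = R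
    · subst hSR
      exact ⟨c, hc, 1, one_mem _, by simp⟩
    · exact ⟨1, one_mem _, _, upperFace_mem_cubeGroup (Finset.mem_erase.2 ⟨hSR, hS⟩) hc,
        by simp⟩
  | one => exact ⟨1, one_mem _, 1, one_mem _, by simp⟩
  | mul f g _ _ hf hg =>
    obtain ⟨c, hc, u, hu, rfl⟩ := hf
    obtain ⟨e, he, v, hv, rfl⟩ := hg
    refine ⟨c * e, mul_mem hc he, (upperFace R e⁻¹ * u * (upperFace R e⁻¹)⁻¹) * v,
      mul_mem (hconj (inv_mem he) hu) hv, ?_⟩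
    rw [map_mul, map_inv]
    group
  | inv f _ hf =>
    obtain ⟨c, hc, u, hu, rfl⟩ := hf
    refine ⟨c⁻¹, inv_mem hc, upperFace R c * u⁻¹ * (upperFace R c)⁻¹,
      hconj hc (inv_mem hu), ?_⟩
    rw [map_inv]
    group

/-- An element of the cube group which is trivial strictly below `S` takes a value in `Γ |S|`
at `S`: minimal faces are split off until `S` itself is minimal. -/
lemma apply_mem_of_mem_cubeGroup (hanti : Antitone Γ)
    (hcomm : ∀ s t, ⁅Γ s, Γ t⁆ ≤ Γ (s + t)) (S : Finset α) :
    ∀ (n : ℕ) (𝒰 : Finset (Finset α)), 𝒰.card = n → (∀ S ∈ 𝒰, ∀ T, S ⊆ T → T ∈ 𝒰) →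
      ∀ f ∈ cubeGroup Γ 𝒰, (∀ T, T ⊂ S → f T = 1) → f S ∈ Γ S.card := by
  intro n
  induction n with
  | zero =>
    intro 𝒰 h𝒰 _ f hf _
    rw [Finset.card_eq_zero] at h𝒰
    subst h𝒰
    rw [apply_eq_one_of_mem_cubeGroup (by simp) hf]
    exact one_mem _
  | succ n ih =>
    intro 𝒰 h𝒰 hup f hf hvan
    obtain ⟨R, hR, hmin⟩ := Finset.exists_min_image 𝒰 Finset.card
      (Finset.card_pos.1 (by omega))
    have hminimal : ∀ T ∈ 𝒰.erase R, ¬ T ⊆ R := fun T hT hTR =>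
      (Finset.mem_erase.1 hT).1
        (Finset.eq_of_subset_of_card_le hTR (hmin T (Finset.mem_erase.1 hT).2))
    have hup' : ∀ S ∈ 𝒰.erase R, ∀ T, S ⊆ T → T ∈ 𝒰.erase R := by
      intro T hT U hTU
      refine Finset.mem_erase.2 ⟨?_, hup T (Finset.mem_erase.1 hT).2 U hTU⟩
      rintro rfl
      exact hminimal T hT hTU
    obtain ⟨c, hc, u, hu, rfl⟩ := exists_eq_upperFace_mul hanti hcomm hup' hf
    have hcard : (𝒰.erase R).card = n := by rw [Finset.card_erase_of_mem hR]; omega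
    have huR : u R = 1 := apply_eq_one_of_mem_cubeGroup hminimal hu
    by_cases hRS : R ⊆ S
    · rcases eq_or_ne R S with rfl | hne
      · simpa [upperFace_apply, huR] using hc
      · have hc1 : c = 1 := by
          simpa [upperFace_apply, huR] using hvan R (Finset.ssubset_iff_subset_ne.2 ⟨hRS, hne⟩)
        subst hc1
        simp only [map_one, one_mul] at hvan ⊢
        exact ih _ hcard hup' u hu hvan
    · have hT : ∀ T ⊆ S, (upperFace R c * u) T = u T := fun T hTS => by
        have : ¬ R ⊆ T := fun h => hRS (h.trans hTS)
        simp [upperFace_apply, this]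
      rw [hT S subset_rfl]
      exact ih _ hcard hup' u hu fun T hTS => by rw [← hT T hTS.1]; exact hvan T hTS

end CubeGroup

section PolynomialSequence

variable {H : Type*} [Group H]

/-- Polynomial sequences of the filtration `Γ`, tested on the cube of dimension `m`: the functions
`g : ℕ → H` such that `T ↦ g |T|` lies in the cube group of `Γ` on the subsets of `Fin m`. -/
def polynomialSequences (Γ : ℕ → Subgroup H) (m : ℕ) : Subgroup (ℕ → H) :=
  (cubeGroup Γ (Finset.univ : Finset (Finset (Fin m)))).comap
    (MonoidHom.pi fun T : Finset (Fin m) => Pi.evalMonoidHom (fun _ : ℕ => H) T.card)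

variable {Γ : ℕ → Subgroup H} {m : ℕ}

lemma pow_choose_mem_polynomialSequences {i : ℕ} {c : H} (hc : c ∈ Γ i) :
    (fun n => c ^ n.choose i) ∈ polynomialSequences Γ m := by
  have key : ∀ 𝒮 : Finset (Finset (Fin m)), (∀ S ∈ 𝒮, S.card = i) →
      (fun T => c ^ (𝒮.filter (· ⊆ T)).card) ∈
        cubeGroup Γ (Finset.univ : Finset (Finset (Fin m))) := by
    intro 𝒮
    induction 𝒮 using Finset.induction_on with
    | empty =>
      intro _
      convert one_mem (cubeGroup Γ (Finset.univ : Finset (Finset (Fin m)))) using 1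
      ext T
      simp
    | insert S 𝒮 hS ih =>
      intro h
      have h1 := ih fun T hT => h T (Finset.mem_insert_of_mem hT)
      have h2 : upperFace S c ∈ cubeGroup Γ (Finset.univ : Finset (Finset (Fin m))) :=
        upperFace_mem_cubeGroup (Finset.mem_univ _) (by
          rw [h S (Finset.mem_insert_self _ _)]; exact hc)
      convert mul_mem h2 h1 using 1
      ext T
      by_cases hST : S ⊆ T
      · rw [Finset.filter_insert, if_pos hST, Finset.card_insert_of_notMem (by simp [hS])]
        simp [upperFace_apply, hST, pow_succ']
      · rw [Finset.filter_insert, if_neg hST]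
        simp [upperFace_apply, hST]
  have h := key (Finset.powersetCard i Finset.univ) fun S hS => (Finset.mem_powersetCard.1 hS).2
  rw [polynomialSequences, Subgroup.mem_comap]
  convert h using 3 with T
  change c ^ T.card.choose i = _
  rw [← Finset.card_powersetCard]
  congr 2
  ext S
  simp [Finset.mem_powersetCard, and_comm]

lemma apply_mem_of_mem_polynomialSequences (hanti : Antitone Γ)
    (hcomm : ∀ s t, ⁅Γ s, Γ t⁆ ≤ Γ (s + t)) {g : ℕ → H} (hg : g ∈ polynomialSequences Γ m)
    {i : ℕ} (hi : i ≤ m) (h1 : ∀ j < i, g j = 1) : g i ∈ Γ i := by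
  obtain ⟨S, -, hS⟩ := Finset.exists_subset_card_eq
    (s := (Finset.univ : Finset (Fin m))) (n := i) (by simpa using hi)
  have := apply_mem_of_mem_cubeGroup hanti hcomm S _ Finset.univ rfl (by simp) _ hg
    fun T hT => h1 _ (by rw [← hS]; exact Finset.card_lt_card hT)
  subst hS
  exact this

/-- The Taylor coefficients of a polynomial sequence are split off one at a time, the `i`-th
contributing the factor `c ^ (p.choose i)` at `p`, a `p`-th power for `0 < i < p`. -/
lemma apply_prime_mem_of_polynomialSequence (hanti : Antitone Γ)
    (hcomm : ∀ s t, ⁅Γ s, Γ t⁆ ≤ Γ (s + t)) {p : ℕ} (hp : p.Prime) {Q : Subgroup H}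
    (hpow : ∀ y ∈ Γ 2, y ^ p ∈ Q) (hQ : Γ p ≤ Q) :
    ∀ i, 2 ≤ i → i ≤ p → ∀ g ∈ polynomialSequences Γ p, (∀ j < i, g j = 1) → g p ∈ Q := by
  intro i hi hip
  induction hk : p - i generalizing i with
  | zero =>
    intro g hg h1
    obtain rfl : i = p := by omega
    exact hQ (apply_mem_of_mem_polynomialSequences hanti hcomm hg le_rfl h1)
  | succ k ih =>
    intro g hg h1
    have hlt : i < p := by omega
    have hc := apply_mem_of_mem_polynomialSequences hanti hcomm hg hip h1
    have hg' := ih (i + 1) (by omega) (by omega) (by omega) _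
      (mul_mem (inv_mem (pow_choose_mem_polynomialSequences (m := p) hc)) hg) (by
        intro j hj
        rcases Nat.lt_succ_iff_lt_or_eq.1 hj with hj | rfl
        · simp [h1 j hj, Nat.choose_eq_zero_of_lt hj]
        · simp)
    have hmem : g i ^ p.choose i ∈ Q := by
      obtain ⟨k, hk⟩ := hp.dvd_choose_self (by omega) hlt
      rw [hk, mul_comm, pow_mul]
      exact hpow _ (pow_mem (hanti hi hc) _)
    simpa using mul_mem hmem hg'

end PolynomialSequence

section RelativeCentralizer

variable {G : Type*} [Group G]

/-- The centralizer of `A` modulo the normal subgroup `N`. -/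
def relCentralizer (A N : Subgroup G) [N.Normal] : Subgroup G :=
  (Subgroup.centralizer (A.map (QuotientGroup.mk' N) : Set (G ⧸ N))).comap (QuotientGroup.mk' N)

lemma commutatorElement_mem_iff (N : Subgroup G) [N.Normal] (g h : G) :
    ⁅g, h⁆ ∈ N ↔ Commute (g : G ⧸ N) (h : G ⧸ N) := by
  rw [← commutatorElement_eq_one_iff_commute, ← QuotientGroup.eq_one_iff]
  rfl

lemma mem_relCentralizer {A N : Subgroup G} [N.Normal] {g : G} :
    g ∈ relCentralizer A N ↔ ∀ h ∈ A, ⁅g, h⁆ ∈ N := by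
  simp only [relCentralizer, Subgroup.mem_comap, Subgroup.mem_centralizer_iff,
    Subgroup.coe_map, Set.forall_mem_image, commutatorElement_mem_iff]
  exact forall₂_congr fun h _ => ⟨fun h => h.symm, fun h => h.symm⟩

lemma commutator_le_iff_le_relCentralizer {A B N : Subgroup G} [N.Normal] :
    ⁅A, B⁆ ≤ N ↔ A ≤ relCentralizer B N := by
  rw [Subgroup.commutator_le]
  exact forall₂_congr fun g _ => mem_relCentralizer.symm

lemma commutator_commutator_le_of_rotate {A B C N : Subgroup G} [N.Normal]
    (h1 : ⁅⁅B, C⁆, A⁆ ≤ N) (h2 : ⁅⁅C, A⁆, B⁆ ≤ N) : ⁅⁅A, B⁆, C⁆ ≤ N := by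
  have key : ∀ X : Subgroup G, X ≤ N ↔ X.map (QuotientGroup.mk' N) = ⊥ := fun X => by
    rw [Subgroup.map_eq_bot_iff, QuotientGroup.ker_mk']
  simp only [key, Subgroup.map_commutator] at h1 h2 ⊢
  exact Subgroup.commutator_commutator_eq_bot_of_rotate h1 h2

lemma commutator_lowerCentralSeries_le (s t : ℕ) :
    ⁅(⊤ : Subgroup G).lowerCentralSeries s, (⊤ : Subgroup G).lowerCentralSeries t⁆ ≤
      (⊤ : Subgroup G).lowerCentralSeries (s + t + 1) := by
  induction t generalizing s with
  | zero => exact le_rfl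
  | succ t ih =>
    rw [Subgroup.commutator_comm, Subgroup.lowerCentralSeries_succ ⊤ t]
    refine commutator_commutator_le_of_rotate ?_ ?_
    · rw [Subgroup.commutator_comm ⊤]
      exact (ih (s + 1)).trans (by rw [show s + 1 + t + 1 = s + (t + 1) + 1 by omega])
    · exact Subgroup.commutator_mono (ih s) le_rfl

end RelativeCentralizer

section HallPetrescu

variable {G : Type*} [Group G]

/-- A form of the Hall–Petrescu congruence: if `c` lies at the start of a series `N` of normal
subgroups centralised by `A`, then `(c a) ^ p ≡ c ^ p a ^ p` modulo the `p`-th powers of `N 1` and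
modulo `N (p - 1)`. The sequence `n ↦ a⁻ⁿ c⁻ⁿ (c a)ⁿ` is polynomial for the lower central series of
`⟨a, c⟩`, and is trivial at `0` and `1`. -/
theorem mk_mul_pow_prime {p : ℕ} (hp : p.Prime) {A Q : Subgroup G} [Q.Normal]
    {N : ℕ → Subgroup G} [∀ s, (N s).Normal] (hA : ∀ s, ⁅N s, A⁆ ≤ N (s + 1))
    (h0 : N 0 ≤ A) (hpow : ∀ y ∈ N 1, y ^ p ∈ Q) (hQ : N (p - 1) ≤ Q) {a c : G} (ha : a ∈ A)
    (hc : c ∈ N 0) : (((c * a) ^ p : G) : G ⧸ Q) = ((c ^ p * a ^ p : G) : G ⧸ Q) := by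
  set K : Subgroup G := Subgroup.closure {a, c} with hK
  have haK : a ∈ K := Subgroup.subset_closure (by simp)
  have hcK : c ∈ K := Subgroup.subset_closure (by simp)
  have hKA : K ≤ A := by
    rw [hK, Subgroup.closure_le]
    rintro x (rfl | rfl)
    exacts [ha, h0 hc]
  -- Modulo `N 1` the generators of `K` commute.
  have hK2 : ⁅K, K⁆ ≤ N 1 := by
    have hcent : ∀ {B : Subgroup G}, a ∈ relCentralizer B (N 1) → c ∈ relCentralizer B (N 1) →
        K ≤ relCentralizer B (N 1) := by
      intro B h h'
      rw [hK, Subgroup.closure_le]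
      rintro x (rfl | rfl)
      exacts [h, h']
    have hcK2 : ∀ h ∈ K, ⁅c, h⁆ ∈ N 1 := fun h hh =>
      hA 0 (Subgroup.commutator_mem_commutator hc (hKA hh))
    refine commutator_le_iff_le_relCentralizer.2 (hcent (mem_relCentralizer.2 ?_)
      (mem_relCentralizer.2 hcK2))
    have : K ≤ relCentralizer (Subgroup.zpowers a) (N 1) := by
      refine hcent ?_ ?_ <;> rw [mem_relCentralizer] <;> rintro _ ⟨k, rfl⟩
      · rw [commutatorElement_eq_one_iff_commute.2 (Commute.self_zpow a k)]
        exact one_mem _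
      · exact hcK2 _ (zpow_mem haK k)
    intro h hh
    rw [← commutatorElement_inv]
    exact inv_mem (mem_relCentralizer.1 (this hh) a (Subgroup.mem_zpowers a))
  have hlcs : ∀ s, 1 ≤ s → K.lowerCentralSeries s ≤ N s := by
    intro s hs
    induction s, hs using Nat.le_induction with
    | base => exact hK2
    | succ s hs ih => exact (Subgroup.commutator_mono ih hKA).trans (hA s)
  -- The lower central series of `K` numbered by weight, so that `Γ 0 = Γ 1 = K`.
  let Γ : ℕ → Subgroup K := fun s => (⊤ : Subgroup K).lowerCentralSeries (s - 1)
  have hΓ : ∀ s, 2 ≤ s → ∀ y ∈ Γ s, (y : G) ∈ N (s - 1) := by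
    intro s hs y hy
    have h2 : (y : G) ∈ K.lowerCentralSeries (s - 1) := by
      rw [← Subgroup.top_subtype_lowerCentralSeries]
      exact ⟨y, hy, rfl⟩
    exact hlcs (s - 1) (by omega) h2
  have hanti : Antitone Γ := fun s t hst =>
    (⊤ : Subgroup K).lowerCentralSeries_antitone (Nat.sub_le_sub_right hst 1)
  have hcomm : ∀ s t, ⁅Γ s, Γ t⁆ ≤ Γ (s + t) := fun s t =>
    (commutator_lowerCentralSeries_le _ _).trans
      ((⊤ : Subgroup K).lowerCentralSeries_antitone (by omega))
  have hpoly : ∀ x : K, (fun n => x ^ n) ∈ polynomialSequences Γ p := fun x => by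
    have hx : x ∈ Γ 1 := Subgroup.mem_top x
    simpa using pow_choose_mem_polynomialSequences (m := p) hx
  let a' : K := ⟨a, haK⟩
  let c' : K := ⟨c, hcK⟩
  have key := apply_prime_mem_of_polynomialSequence hanti hcomm hp (Q := Q.subgroupOf K)
    (fun y hy => Subgroup.mem_subgroupOf.2 (by simpa using hpow y (hΓ 2 le_rfl y hy)))
    (fun y hy => Subgroup.mem_subgroupOf.2 (hQ (hΓ p hp.two_le y hy))) 2 le_rfl hp.two_le _
    (mul_mem (inv_mem (mul_mem (hpoly c') (hpoly a'))) (hpoly (c' * a'))) (by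
      intro j hj
      interval_cases j <;> simp)
  refine (QuotientGroup.eq.2 ?_).symm
  simpa [Subgroup.mem_subgroupOf, a', c'] using key

/-- The Hall–Petrescu congruence for commutators, from `[x, h ^ p] h ^ p = ([x, h] h) ^ p`. -/
theorem mk_commutator_pow_prime {p : ℕ} (hp : p.Prime) {A Q : Subgroup G} [Q.Normal]
    {N : ℕ → Subgroup G} [∀ s, (N s).Normal] (hA : ∀ s, ⁅N s, A⁆ ≤ N (s + 1))
    (h0 : N 0 ≤ A) (hpow : ∀ y ∈ N 1, y ^ p ∈ Q) (hQ : N (p - 1) ≤ Q) {x h : G} (hh : h ∈ A)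
    (hc : ⁅x, h⁆ ∈ N 0) : ((⁅x, h ^ p⁆ : G) : G ⧸ Q) = ((⁅x, h⁆ ^ p : G) : G ⧸ Q) := by
  have h1 := mk_mul_pow_prime hp hA h0 hpow hQ hh hc
  have h2 : (⁅x, h⁆ * h) ^ p = ⁅x, h ^ p⁆ * h ^ p := by
    simp [commutatorElement_def, conj_pow]
  rw [h2, QuotientGroup.mk_mul, QuotientGroup.mk_mul] at h1
  exact mul_right_cancel h1

end HallPetrescu

/-! ### Uniserial potent series -/

/-- A descending series `G = E 1 ≥ E 2 = G' ≥ E 3 ≥ ⋯` of normal subgroups in which commutation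
with `G` raises the index by `1` and taking `p`-th powers raises it by `d`, each term being
generated by what these two operations put into it, with `E (d + 2) = (G') ^ p`, and with factors from
`E 2` to `E (d + 2)` that are generated by each of their nontrivial elements. The term `E 0` plays no
role. -/
structure PotentSeries (G : Type*) [Group G] (p d : ℕ) where
  /-- The terms of the series. -/
  E : ℕ → Subgroup G
  normal : ∀ j, (E j).Normal
  prime : p.Prime
  one_le : 1 ≤ d
  le_pred : d ≤ p - 1
  one : E 1 = ⊤
  two : E 2 = commutator G
  antitone : Antitone E
  commutator_top_le : ∀ j, ⁅E j, (⊤ : Subgroup G)⁆ ≤ E (j + 1)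
  pow_mem : ∀ j, 2 ≤ j → ∀ y ∈ E j, y ^ p ∈ E (j + d)
  succ_le : ∀ j, 2 ≤ j →
    E (j + 1) ≤ ⁅E j, (⊤ : Subgroup G)⁆ ⊔ powerSubgroup (E (max 2 (j + 1 - d))) p
  le_powerSubgroup : E (d + 2) ≤ powerSubgroup (E 2) p
  cyclic : ∀ j, 2 ≤ j → j ≤ d + 1 → ∀ u ∈ E j, u ∉ E (j + 1) →
    E j ≤ Subgroup.zpowers u ⊔ E (j + 1)

namespace PotentSeries

variable {G : Type*} [Group G] {p d : ℕ} (S : PotentSeries G p d)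

instance (j : ℕ) : (S.E j).Normal := S.normal j

lemma pow_mem' {j k : ℕ} (hj : 2 ≤ j) (hk : k ≤ j + d) {y : G} (hy : y ∈ S.E j) :
    y ^ p ∈ S.E k :=
  S.antitone hk (S.pow_mem j hj y hy)

lemma commutatorElement_mem {j : ℕ} (x : G) {h : G} (hh : h ∈ S.E j) : ⁅x, h⁆ ∈ S.E (j + 1) := by
  rw [← commutatorElement_inv]
  exact inv_mem (S.commutator_top_le j (Subgroup.commutator_mem_commutator hh trivial))

/-- The series is an `N`-series. For `p`-th powers the Hall–Petrescu congruence reduces the claim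
to commutators with smaller second index. -/
lemma commutator_le (j : ℕ) (hj : 1 ≤ j) : ∀ i, 1 ≤ i → ⁅S.E i, S.E j⁆ ≤ S.E (i + j) := by
  induction j using Nat.strong_induction_on with
  | _ j ih =>
    intro i hi
    obtain rfl | ⟨k, hk, rfl⟩ : j = 1 ∨ ∃ k, 1 ≤ k ∧ j = k + 1 := by
      rcases Nat.eq_or_lt_of_le hj with h | h
      · exact Or.inl h.symm
      · exact Or.inr ⟨j - 1, by omega, by omega⟩
    · rw [S.one]
      exact S.commutator_top_le i
    have hcomm : ⁅S.E k, (⊤ : Subgroup G)⁆ ≤ relCentralizer (S.E i) (S.E (i + (k + 1))) := by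
      rw [← commutator_le_iff_le_relCentralizer]
      refine commutator_commutator_le_of_rotate ?_ ?_
      · rw [Subgroup.commutator_comm ⊤]
        refine (Subgroup.commutator_mono (S.commutator_top_le i) le_rfl).trans ?_
        exact (ih k (by omega) hk (i + 1) (by omega)).trans (S.antitone (by omega))
      · exact (Subgroup.commutator_mono (ih k (by omega) hk i hi) le_rfl).trans
          (S.commutator_top_le _)
    rw [Subgroup.commutator_comm, commutator_le_iff_le_relCentralizer]
    rcases Nat.eq_or_lt_of_le hk with rfl | hk2
    · rwa [S.one, ← _root_.commutator_def, ← S.two] at hcomm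
    refine (S.succ_le k hk2).trans (sup_le hcomm ((Subgroup.closure_le _).2 ?_))
    rintro _ ⟨a, ha, rfl⟩
    have hd := S.one_le
    have hdp := S.le_pred
    obtain ⟨m, hm⟩ : ∃ m, m = max 2 (k + 1 - d) := ⟨_, rfl⟩
    have hm2 : 2 ≤ m := hm ▸ le_max_left _ _
    have hmk : m ≤ k := by omega
    have hkm : k + 1 ≤ m + d := by omega
    rw [← hm] at ha
    refine mem_relCentralizer.2 fun b hb => ?_
    have hba : ⁅b, a⁆ ∈ S.E (i + m) :=
      ih m (by omega) (by omega) i hi (Subgroup.commutator_mem_commutator hb ha)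
    have hmul : d ≤ (p - 1) * m := by nlinarith
    have key := mk_commutator_pow_prime S.prime (A := S.E m) (Q := S.E (i + (k + 1)))
      (N := fun s => S.E (i + m + s * m))
      (fun s => (ih m (by omega) (by omega) _ (by omega)).trans
        (S.antitone (by rw [Nat.succ_mul]; omega)))
      (S.antitone (by omega))
      (fun y hy => S.pow_mem' (by omega) (by omega) hy)
      (S.antitone (by omega)) ha (by simpa using hba)
    rw [(QuotientGroup.eq_one_iff _).2 (S.pow_mem' (by omega) (by omega) hba),
      QuotientGroup.eq_one_iff] at key
    rw [← commutatorElement_inv]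
    exact inv_mem key

lemma lt_pred_mul (S : PotentSeries G p d) {j : ℕ} (hj : 2 ≤ j) : d + 1 ≤ (p - 1) * j := by
  have := S.one_le
  have := S.le_pred
  nlinarith

lemma mk_commutator_pow {j k : ℕ} (hj : 2 ≤ j) (hk : k ≤ j + d + 2) (x : G) {h : G}
    (hh : h ∈ S.E j) : ((⁅x, h ^ p⁆ : G) : G ⧸ S.E k) = ((⁅x, h⁆ ^ p : G) : G ⧸ S.E k) := by
  have hmul := S.lt_pred_mul hj
  refine mk_commutator_pow_prime S.prime (A := S.E j) (N := fun s => S.E (j + 1 + s * j))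
    (fun s => (S.commutator_le j (by omega) _ (by omega)).trans
      (S.antitone (by rw [Nat.succ_mul]; omega)))
    (S.antitone (by omega)) (fun y hy => S.pow_mem' (by omega) (by omega) hy)
    (S.antitone (by omega)) hh (S.antitone (by omega) (S.commutatorElement_mem x hh))

lemma mk_mul_pow {j k : ℕ} (hj : 2 ≤ j) (hk : k ≤ j + d + 1) {a b : G}
    (ha : a ∈ S.E j) (hb : b ∈ S.E j) :
    (((a * b) ^ p : G) : G ⧸ S.E k) = ((a ^ p * b ^ p : G) : G ⧸ S.E k) := by
  have hmul := S.lt_pred_mul hj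
  refine mk_mul_pow_prime S.prime (A := S.E j) (N := fun s => S.E (j + s * j))
    (fun s => (S.commutator_le j (by omega) _ (by omega)).trans
      (S.antitone (by rw [Nat.succ_mul]; omega)))
    (S.antitone (by omega)) (fun y hy => S.pow_mem' (by omega) (by omega) hy)
    (S.antitone (by omega)) hb (by simpa using ha)

/-- The `p`-th power map sends congruences modulo `E (j + 1)` to congruences modulo
`E (j + d + 1)`. -/
lemma mk_pow_congr {j k : ℕ} (hj : 2 ≤ j) (hk : k ≤ j + d + 1) {a b : G}
    (ha : a ∈ S.E j) (hab : (a : G ⧸ S.E (j + 1)) = b) :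
    ((a ^ p : G) : G ⧸ S.E k) = ((b ^ p : G) : G ⧸ S.E k) := by
  have hz : a⁻¹ * b ∈ S.E (j + 1) := QuotientGroup.eq.1 hab
  have h := S.mk_mul_pow hj hk ha (S.antitone (Nat.le_succ j) hz)
  rw [mul_inv_cancel_left, QuotientGroup.mk_mul _ (a ^ p),
    (QuotientGroup.eq_one_iff _).2 (S.pow_mem' (by omega) (by omega) hz), mul_one] at h
  exact h.symm

lemma mk_commutator_congr {j k : ℕ} (hk : k ≤ j + 1) (x : G) {a b : G}
    (hab : (a : G ⧸ S.E j) = b) :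
    ((⁅x, a⁆ : G) : G ⧸ S.E k) = ((⁅x, b⁆ : G) : G ⧸ S.E k) := by
  have hz : a⁻¹ * b ∈ S.E j := QuotientGroup.eq.1 hab
  rw [QuotientGroup.eq]
  have h := S.antitone hk (S.commutatorElement_mem x hz)
  have h2 := (S.normal k).conj_mem _ h a
  convert h2 using 1
  simp only [commutatorElement_def]
  group

/-- The elements congruent modulo `E (j + d + 1)` to a `p`-th power of an element of `E j`. -/
def powerCosets (j : ℕ) (hj : 2 ≤ j) : Subgroup G where
  carrier := {y | ∃ e ∈ S.E j, (y : G ⧸ S.E (j + d + 1)) = ((e ^ p : G) : G ⧸ S.E (j + d + 1))}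
  one_mem' := ⟨1, one_mem _, by simp⟩
  mul_mem' := by
    rintro y z ⟨e, he, hy⟩ ⟨f, hf, hz⟩
    refine ⟨e * f, mul_mem he hf, ?_⟩
    rw [S.mk_mul_pow hj le_rfl he hf, QuotientGroup.mk_mul, QuotientGroup.mk_mul, hy, hz]
  inv_mem' := by
    rintro y ⟨e, he, hy⟩
    refine ⟨e⁻¹, inv_mem he, ?_⟩
    rw [inv_pow, QuotientGroup.mk_inv, QuotientGroup.mk_inv, hy]

lemma powerSubgroup_le_powerCosets (j : ℕ) (hj : 2 ≤ j) :
    powerSubgroup (S.E j) p ≤ S.powerCosets j hj := by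
  refine (Subgroup.closure_le _).2 ?_
  rintro _ ⟨e, he, rfl⟩
  exact ⟨e, he, rfl⟩

lemma le_powerCosets {j : ℕ} (hj : 2 ≤ j) : S.E (j + d) ≤ S.powerCosets j hj := by
  induction j, hj using Nat.le_induction with
  | base =>
    rw [Nat.add_comm]
    exact S.le_powerSubgroup.trans (S.powerSubgroup_le_powerCosets 2 le_rfl)
  | succ j hj ih =>
    have h := S.succ_le (j + d) (by omega)
    rw [show max 2 (j + d + 1 - d) = j + 1 by omega] at h
    rw [Nat.add_right_comm]
    refine h.trans (sup_le (Subgroup.commutator_le.2 fun y hy g _ => ?_)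
      (S.powerSubgroup_le_powerCosets _ _))
    rw [← commutatorElement_inv]
    obtain ⟨e, he, hye⟩ := ih hy
    refine inv_mem ⟨⁅g, e⁆, S.commutatorElement_mem g he, ?_⟩
    rw [S.mk_commutator_congr (by omega) g hye, S.mk_commutator_pow hj (by omega) g he]

/-- From `E 2` on, the terms of the series `d` steps further down consist of `p`-th powers, up to
the next term. -/
lemma exists_mk_eq_pow {j k l : ℕ} (hj : 2 ≤ j) (hk : k ≤ j + d + 1) (hl : l = j + d) {y : G}
    (hy : y ∈ S.E l) : ∃ e ∈ S.E j, (y : G ⧸ S.E k) = ((e ^ p : G) : G ⧸ S.E k) := by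
  subst hl
  obtain ⟨e, he, h⟩ := S.le_powerCosets hj hy
  exact ⟨e, he, QuotientGroup.eq.2 (S.antitone hk (QuotientGroup.eq.1 h))⟩

/-! ### Covering the factors of the series by commutators with a fixed element -/

/-- Every element of `E (j + 1)` is, modulo `E (j + 2)`, a commutator of `x` with an element
of `E j`. -/
def Covers (x : G) (j : ℕ) : Prop :=
  ∀ e ∈ S.E (j + 1), ∃ h ∈ S.E j, ((⁅x, h⁆ : G) : G ⧸ S.E (j + 2)) = (e : G ⧸ S.E (j + 2))

/-- Every element of `E j` is, modulo `E (j + 1)`, a commutator of `x` with some element. -/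
def Reaches (x : G) (j : ℕ) : Prop :=
  ∀ e ∈ S.E j, ∃ h, ((⁅x, h⁆ : G) : G ⧸ S.E (j + 1)) = (e : G ⧸ S.E (j + 1))

variable {S} in
lemma Covers.reaches {x : G} {j : ℕ} (h : S.Covers x j) : S.Reaches x (j + 1) := fun e he =>
  let ⟨y, _, hy⟩ := h e he
  ⟨y, hy⟩

variable {S} in
lemma Covers.add {x : G} {j : ℕ} (hj : 2 ≤ j) (h : S.Covers x j) : S.Covers x (j + d) := by
  intro e he
  obtain ⟨f, hf, hef⟩ := S.exists_mk_eq_pow (j := j + 1) (k := j + d + 2) (by omega) (by omega)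
    (by omega) he
  obtain ⟨y, hy, hyf⟩ := h f hf
  refine ⟨y ^ p, S.pow_mem j hj y hy, ?_⟩
  rw [S.mk_commutator_pow hj le_rfl x hy, hef]
  exact S.mk_pow_congr (by omega) (by omega) (S.commutatorElement_mem x hy) hyf

variable {S} in
lemma Covers.add_mul {x : G} {j : ℕ} (hj : 2 ≤ j) (h : S.Covers x j) (k : ℕ) :
    S.Covers x (j + k * d) := by
  induction k with
  | zero => simpa using h
  | succ k ih =>
    rw [Nat.succ_mul, ← Nat.add_assoc]
    exact ih.add (by omega)

lemma commutator_top_le_add {j : ℕ} (hj : 2 ≤ j) (h : ⁅S.E j, (⊤ : Subgroup G)⁆ ≤ S.E (j + 2)) :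
    ⁅S.E (j + d), (⊤ : Subgroup G)⁆ ≤ S.E (j + d + 2) := by
  refine Subgroup.commutator_le.2 fun y hy g _ => ?_
  obtain ⟨e, he, hye⟩ := S.exists_mk_eq_pow (k := j + d + 1) hj le_rfl rfl hy
  have hge : ⁅g, e⁆ ∈ S.E (j + 2) := by
    rw [← commutatorElement_inv]
    exact inv_mem (h (Subgroup.commutator_mem_commutator he trivial))
  rw [← commutatorElement_inv, inv_mem_iff, ← QuotientGroup.eq_one_iff,
    S.mk_commutator_congr le_rfl g hye, S.mk_commutator_pow hj le_rfl g he,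
    QuotientGroup.eq_one_iff]
  exact S.pow_mem' (by omega) (by omega) hge

variable {S} in
/-- If `G` centralises `E (j + d - 1) / E (j + d + 1)`, the commutators of weight `p` in the
Hall–Petrescu congruence lie one step deeper than their weight says, so `[x, g ^ p] ≡ [x, g] ^ p`
modulo `E (j + d + 1)` for every `g` with `[x, g] ∈ E j`. -/
lemma Reaches.add {x : G} {j : ℕ} (hj : 2 ≤ j) (h : S.Reaches x j)
    (hc : ⁅S.E (j + d - 1), (⊤ : Subgroup G)⁆ ≤ S.E (j + d + 1)) : S.Reaches x (j + d) := by
  have hd := S.one_le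
  have hdp := S.le_pred
  intro e he
  obtain ⟨f, hf, hef⟩ := S.exists_mk_eq_pow (j := j) (k := j + d + 1) (by omega) (by omega)
    (by omega) he
  obtain ⟨y, hyf⟩ := h f hf
  have hxy : ⁅x, y⁆ ∈ S.E j := by
    have h1 := mul_mem (inv_mem hf) (S.antitone (Nat.le_succ j) (QuotientGroup.eq.1 hyf))
    have h2 := inv_mem (S.antitone (Nat.le_succ j) (QuotientGroup.eq.1 hyf))
    simpa using mul_mem hf h2
  refine ⟨y ^ p, ?_⟩
  -- The centralised factor makes the series `N` skip the index `j + d`.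
  have key := mk_commutator_pow_prime S.prime (A := ⊤) (Q := S.E (j + d + 1))
    (N := fun s => S.E (if s < d then j + s else j + s + 1))
    (fun s => by
      rcases lt_trichotomy (s + 1) d with hs | hs | hs
      · rw [if_pos hs, if_pos (by omega)]
        exact S.commutator_top_le _
      · rw [if_pos (by omega), if_neg (by omega)]
        rwa [show j + s = j + d - 1 by omega, show j + (s + 1) + 1 = j + d + 1 by omega]
      · rw [if_neg (by omega), if_neg (by omega)]
        exact S.commutator_top_le _)
    le_top
    (fun y hy => S.pow_mem' (j := j + 1) (by omega) (by omega)
      (S.antitone (by split_ifs <;> omega) hy))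
    (S.antitone (by split_ifs <;> omega)) trivial
    (S.antitone (by split_ifs <;> omega) hxy)
  rw [key, hef]
  exact S.mk_pow_congr hj le_rfl hxy hyf

lemma cyclic' {j : ℕ} (hj : 2 ≤ j) (hjd : j ≤ d + 2) {u : G} (hu : u ∈ S.E j)
    (hu' : u ∉ S.E (j + 1)) : S.E j ≤ Subgroup.zpowers u ⊔ S.E (j + 1) := by
  have hd := S.one_le
  rcases Nat.lt_or_eq_of_le hjd with hlt | rfl
  · exact S.cyclic j hj (by omega) u hu hu'
  intro v hv
  obtain ⟨f, hf, huf⟩ := S.exists_mk_eq_pow (j := 2) (k := d + 2 + 1) le_rfl (by omega)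
    (by omega) hu
  obtain ⟨e, he, hve⟩ := S.exists_mk_eq_pow (j := 2) (k := d + 2 + 1) le_rfl (by omega)
    (by omega) hv
  have hf3 : f ∉ S.E 3 := fun h => hu' <| by
    rw [← QuotientGroup.eq_one_iff, huf, QuotientGroup.eq_one_iff]
    exact S.pow_mem' (by omega) (by omega) h
  obtain ⟨_, ⟨k, rfl⟩, z, hz, rfl⟩ := Subgroup.mem_sup_of_normal_right.1
    (S.cyclic 2 le_rfl (by omega) f hf hf3 he)
  have h1 : ((f ^ k * z : G) : G ⧸ S.E (2 + 1)) = ((f ^ k : G) : G ⧸ S.E (2 + 1)) := by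
    rw [QuotientGroup.mk_mul, (QuotientGroup.eq_one_iff z).2 hz, mul_one]
  have h2 := S.mk_pow_congr (k := d + 2 + 1) le_rfl (by omega) he h1
  have h3 : (v : G ⧸ S.E (d + 2 + 1)) = ((u ^ k : G) : G ⧸ S.E (d + 2 + 1)) := by
    rw [hve, h2, QuotientGroup.mk_zpow, huf, ← zpow_natCast, ← zpow_mul, mul_comm, zpow_mul,
      zpow_natCast, QuotientGroup.mk_zpow]
  have h4 : (u ^ k)⁻¹ * v ∈ S.E (d + 2 + 1) := QuotientGroup.eq.1 h3.symm
  simpa using Subgroup.mul_mem_sup (Subgroup.zpow_mem_zpowers u k) h4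

lemma covers_of_notMem {j : ℕ} (hj : 1 ≤ j) (hjd : j ≤ d + 1) {x : G}
    (hx : x ∉ relCentralizer (S.E j) (S.E (j + 2))) : S.Covers x j := by
  intro e he
  rw [mem_relCentralizer] at hx
  push Not at hx
  obtain ⟨h, hh, hxh⟩ := hx
  have hu := S.commutatorElement_mem x hh
  obtain ⟨_, ⟨k, rfl⟩, z, hz, rfl⟩ := Subgroup.mem_sup_of_normal_right.1
    (S.cyclic' (by omega) (by omega) hu hxh he)
  refine ⟨h ^ k, zpow_mem hh k, ?_⟩
  have hcomm : Commute ((⁅x, h⁆ : G) : G ⧸ S.E (j + 2)) (h : G ⧸ S.E (j + 2)) :=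
    (commutatorElement_mem_iff _ _ _).1
      (S.commutator_top_le _ (Subgroup.commutator_mem_commutator hu trivial))
  have h1 : ⁅x, h ^ k⁆ = (⁅x, h⁆ * h) ^ k * (h ^ k)⁻¹ := by
    simp [commutatorElement_def, conj_zpow]
  rw [h1, QuotientGroup.mk_mul, QuotientGroup.mk_zpow, QuotientGroup.mk_mul, hcomm.mul_zpow,
    QuotientGroup.mk_inv, QuotientGroup.mk_zpow, mul_inv_cancel_right, QuotientGroup.mk_mul,
    (QuotientGroup.eq_one_iff z).2 hz, mul_one]
  rfl

lemma le_of_commutator_top_le {j : ℕ} (hj : 1 ≤ j) (hjd : j ≤ d)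
    (h : ⁅S.E j, (⊤ : Subgroup G)⁆ ≤ S.E (j + 2)) : S.E (j + 1) ≤ S.E (j + 2) := by
  rcases Nat.eq_or_lt_of_le hj with rfl | hj2
  · rwa [S.one, ← _root_.commutator_def, ← S.two] at h
  · refine (S.succ_le j hj2).trans (sup_le h ?_)
    rw [show max 2 (j + 1 - d) = 2 by omega]
    refine (Subgroup.closure_le _).2 ?_
    rintro _ ⟨y, hy, rfl⟩
    exact S.pow_mem' le_rfl (by omega) hy

lemma covers_of_le {j : ℕ} (h : S.E (j + 1) ≤ S.E (j + 2)) (x : G) : S.Covers x j :=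
  fun e he => ⟨1, one_mem _, by
    rw [commutatorElement_one_right]
    exact ((QuotientGroup.eq_one_iff e).2 (h he)).symm⟩

/-- An element outside all proper centralisers `C_G(E j / E (j + 2))`, `1 ≤ j ≤ d + 1`, reaches
every factor of the series. If `C_G(E (d + 1) / E (d + 3))` is proper, then the factors from `E 3`
to `E (d + 3)` are covered and `p`-th powers take care of all lower ones; otherwise the factors
`E (2 + k d) / E (3 + k d)` are reached by `Reaches.add`. -/
lemma reaches_of_notMem {x : G} (hx : ∀ j, 1 ≤ j → j ≤ d + 1 →
    relCentralizer (S.E j) (S.E (j + 2)) ≠ ⊤ → x ∉ relCentralizer (S.E j) (S.E (j + 2)))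
    (m : ℕ) (hm : 2 ≤ m) : S.Reaches x m := by
  have hd := S.one_le
  have htop : ∀ j, relCentralizer (S.E j) (S.E (j + 2)) = ⊤ →
      ⁅S.E j, (⊤ : Subgroup G)⁆ ≤ S.E (j + 2) := fun j h => by
    rw [Subgroup.commutator_comm, commutator_le_iff_le_relCentralizer, h]
  have hcov : ∀ j, 1 ≤ j → j ≤ d → S.Covers x j := fun j h1 h2 => by
    by_cases h : relCentralizer (S.E j) (S.E (j + 2)) = ⊤
    · exact S.covers_of_le (S.le_of_commutator_top_le h1 h2 (htop j h)) x
    · exact S.covers_of_notMem h1 (by omega) (hx j h1 (by omega) h)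
  obtain ⟨i, k, hi, rfl⟩ : ∃ i k, i < d ∧ m = 2 + i + k * d :=
    ⟨(m - 2) % d, (m - 2) / d, Nat.mod_lt _ hd, by
      have := Nat.mod_add_div' (m - 2) d
      omega⟩
  have hpos : ∀ i, 1 ≤ i → S.Covers x (1 + i) → S.Reaches x (2 + i + k * d) := fun i h1 h2 => by
    have := (h2.add_mul (by omega) k).reaches
    rwa [show 1 + i + k * d + 1 = 2 + i + k * d by omega] at this
  rcases Nat.eq_zero_or_pos i with rfl | hi0
  · clear hpos hm
    induction k with
    | zero => simpa using (hcov 1 le_rfl hd).reaches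
    | succ k ih =>
      by_cases h : relCentralizer (S.E (d + 1)) (S.E (d + 1 + 2)) = ⊤
      · have hk : ⁅S.E (d + 1 + k * d), (⊤ : Subgroup G)⁆ ≤ S.E (d + 1 + k * d + 2) := by
          clear ih
          induction k with
          | zero => simpa using htop _ h
          | succ k ih =>
            rw [Nat.succ_mul, ← Nat.add_assoc]
            exact S.commutator_top_le_add (by omega) ih
        have := ih.add (by omega) (by
          rwa [show 2 + 0 + k * d + d - 1 = d + 1 + k * d by omega,
            show 2 + 0 + k * d + d + 1 = d + 1 + k * d + 2 by omega])
        rwa [Nat.succ_mul, ← Nat.add_assoc]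
      · have := ((S.covers_of_notMem (by omega) le_rfl (hx _ (by omega) le_rfl h)).add_mul
          (by omega) k).reaches
        rwa [show d + 1 + k * d + 1 = 2 + 0 + (k + 1) * d by rw [Nat.succ_mul]; omega] at this
  · exact hpos i hi0 (hcov (1 + i) (by omega) (by omega))

/-- If `x` reaches every factor, then elements of `G'` are approximated successively by
commutators `[x, g]`. -/
lemma exists_mk_commutator_eq {x : G} (hx : ∀ m, 2 ≤ m → S.Reaches x m) {c : G}
    (hc : c ∈ commutator G) (m : ℕ) (hm : 2 ≤ m) :
    ∃ g, ((⁅x, g⁆ : G) : G ⧸ S.E m) = (c : G ⧸ S.E m) := by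
  induction m, hm using Nat.le_induction with
  | base =>
    refine ⟨1, ?_⟩
    rw [commutatorElement_one_right]
    exact ((QuotientGroup.eq_one_iff c).2 (S.two ▸ hc)).symm
  | succ m hm ih =>
    obtain ⟨g, hg⟩ := ih
    have hz : ⁅x, g⁆⁻¹ * c ∈ S.E m := QuotientGroup.eq.1 hg
    obtain ⟨h, hh⟩ := hx m hm _ hz
    refine ⟨g * h, ?_⟩
    have hcomm : Commute ((⁅x, g⁆⁻¹ * c : G) : G ⧸ S.E (m + 1)) (g : G ⧸ S.E (m + 1)) :=
      (commutatorElement_mem_iff _ _ _).1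
        (S.commutator_top_le _ (Subgroup.commutator_mem_commutator hz trivial))
    have h1 : ⁅x, g * h⁆ = ⁅x, g⁆ * (g * ⁅x, h⁆ * g⁻¹) := by
      simp only [commutatorElement_def]
      group
    rw [h1, QuotientGroup.mk_mul, QuotientGroup.mk_mul, QuotientGroup.mk_mul, hh, ← hcomm.eq,
      QuotientGroup.mk_inv, mul_inv_cancel_right, ← QuotientGroup.mk_mul, mul_inv_cancel_left]

end PotentSeries

/-! ### Finite `p`-groups -/

section PGroup

variable {G : Type*} [Group G] [Finite G] {p : ℕ} [Fact p.Prime]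

lemma eq_bot_of_le_commutator_top (hG : IsPGroup p G) {Q : Subgroup G}
    (hQ : Q ≤ ⁅Q, (⊤ : Subgroup G)⁆) : Q = ⊥ := by
  have := hG.isNilpotent
  obtain ⟨n, hn⟩ := Subgroup.nilpotent_iff_lowerCentralSeries.1 this
  have h : ∀ n, Q ≤ (⊤ : Subgroup G).lowerCentralSeries n := by
    intro n
    induction n with
    | zero => exact le_top
    | succ n ih => exact hQ.trans (Subgroup.commutator_mono ih le_rfl)
  exact le_bot_iff.1 (hn ▸ h n)

/-- A normal subgroup `Q` of a finite `p`-group with `Q ≤ [Q, G] Q ^ p` is trivial: modulo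
`[Q, G]` it is abelian, so `p` can be cancelled from any exponent of `Q / [Q, G]`. -/
lemma eq_bot_of_le_commutator_top_sup_powerSubgroup (hG : IsPGroup p G) {Q : Subgroup G}
    [Q.Normal] (hQ : Q ≤ ⁅Q, (⊤ : Subgroup G)⁆ ⊔ powerSubgroup Q p) : Q = ⊥ := by
  refine eq_bot_of_le_commutator_top hG ?_
  set R : Subgroup G := ⁅Q, (⊤ : Subgroup G)⁆ with hR
  have hRQ : R ≤ Q := Subgroup.commutator_le_left _ _
  have hcomm : ∀ {a b : G}, a ∈ Q → Commute (a : G ⧸ R) (b : G ⧸ R) := fun ha =>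
    (commutatorElement_mem_iff R _ _).1 (Subgroup.commutator_mem_commutator ha trivial)
  have key : ∀ k, (∀ y ∈ Q, y ^ p ^ k ∈ R) → Q ≤ R := by
    intro k
    induction k with
    | zero => intro h y hy; simpa using h y hy
    | succ k ih =>
      intro h
      let T : Subgroup G :=
        { carrier := {y | y ∈ Q ∧ y ^ p ^ k ∈ R}
          one_mem' := ⟨one_mem _, by simp⟩
          mul_mem' := by
            rintro a b ⟨ha, ha'⟩ ⟨hb, hb'⟩
            refine ⟨mul_mem ha hb, ?_⟩
            rw [← QuotientGroup.eq_one_iff] at ha' hb' ⊢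
            rw [QuotientGroup.mk_pow, QuotientGroup.mk_mul, (hcomm ha).mul_pow,
              ← QuotientGroup.mk_pow, ← QuotientGroup.mk_pow, ha', hb', one_mul]
          inv_mem' := by
            rintro a ⟨ha, ha'⟩
            exact ⟨inv_mem ha, by rw [inv_pow]; exact inv_mem ha'⟩ }
      have hT : Q ≤ T := by
        refine hQ.trans (sup_le (fun y hy => ⟨hRQ hy, pow_mem hy _⟩)
          ((Subgroup.closure_le _).2 ?_))
        rintro _ ⟨y, hy, rfl⟩
        exact ⟨pow_mem hy p, by rw [← pow_mul, ← pow_succ']; exact h y hy⟩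
      exact ih fun y hy => (hT hy).2
  obtain ⟨n, hn⟩ := IsPGroup.iff_card.1 hG
  exact key n fun y _ => by rw [← hn, pow_card_eq_one']; exact one_mem _

open scoped Pointwise in
/-- A finite `p`-group is not the union of `p` or fewer proper subgroups. -/
lemma exists_forall_notMem_of_card_le (hG : IsPGroup p G) {ι : Type*} (s : Finset ι)
    (hs : s.card ≤ p) (H : ι → Subgroup G) (hH : ∀ i ∈ s, H i ≠ ⊤) :
    ∃ x, ∀ i ∈ s, x ∉ H i := by
  classical
  have hp : p.Prime := Fact.out
  by_contra! hcon
  have hcover : ⋃ i ∈ s, (1 : G) • (H i : Set G) = Set.univ := by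
    ext x
    obtain ⟨i, hi, hx⟩ := hcon x
    simp only [one_smul, Set.mem_iUnion, Set.mem_univ, iff_true]
    exact ⟨i, hi, hx⟩
  have hidx : ∀ i ∈ s, ((H i).index : ℚ)⁻¹ ≤ (p : ℚ)⁻¹ := fun i hi => by
    obtain ⟨n, hn⟩ := hG.index (H i)
    have hn0 : n ≠ 0 := by
      rintro rfl
      exact hH i hi (Subgroup.index_eq_one.1 (by simpa using hn))
    have hpi : p ≤ (H i).index := hn ▸ Nat.le_self_pow hn0 p
    have : (0 : ℚ) < p := by exact_mod_cast hp.pos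
    gcongr
  have hp0 : (0 : ℚ) < (p : ℚ)⁻¹ := by
    have : (0 : ℚ) < p := by exact_mod_cast hp.pos
    positivity
  have hsum : ∑ i ∈ s, ((H i).index : ℚ)⁻¹ ≤ s.card * (p : ℚ)⁻¹ := by
    simpa using Finset.sum_le_sum hidx
  have hone := Subgroup.one_le_sum_inv_index_of_leftCoset_cover hcover
  have hsp : (s.card : ℚ) * (p : ℚ)⁻¹ ≤ 1 := by
    rw [← div_eq_mul_inv]
    exact div_le_one_of_le₀ (by exact_mod_cast hs) (by positivity)
  -- In the case of equality Neumann's lemma makes the subgroups pairwise disjoint, but all of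
  -- them contain `1`.
  have hdisj := Subgroup.pairwiseDisjoint_leftCoset_cover_of_sum_inv_index_eq_one hcover
    (le_antisymm (hsum.trans hsp) hone)
  have hcard : s.card ≤ 1 := Finset.card_le_one.2 fun i hi j hj => by
    by_contra hij
    have hfin : ∀ k, (H k).FiniteIndex := fun k => inferInstance
    have hdis : Disjoint ((1 : G) • (H i : Set G)) ((1 : G) • (H j : Set G)) :=
      hdisj (x := i) (by simp [hi, hfin]) (y := j) (by simp [hj, hfin]) hij
    have hmem : ∀ k, (1 : G) ∈ (1 : G) • (H k : Set G) := fun k => by simp [one_mem]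
    exact Set.disjoint_left.1 hdis (hmem i) (hmem j)
  have h2 : (s.card : ℚ) ≤ 1 := by exact_mod_cast hcard
  have h3 : (p : ℚ)⁻¹ < 1 := inv_lt_one_of_one_lt₀ (by exact_mod_cast hp.one_lt)
  nlinarith

lemma PotentSeries.exists_eq_bot (hG : IsPGroup p G) {d : ℕ} (S : PotentSeries G p d) :
    ∃ n, 2 ≤ n ∧ S.E n = ⊥ := by
  have hd := S.one_le
  set n := max 2 (Function.argmin fun n => Nat.card (S.E n)) with hn
  have hstab : ∀ m, n ≤ m → S.E m = S.E n := by
    have h : ∀ m, Function.argmin (fun n => Nat.card (S.E n)) ≤ m →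
        S.E m = S.E (Function.argmin fun n => Nat.card (S.E n)) := fun m hm =>
      Subgroup.eq_of_le_of_card_ge (S.antitone hm)
        (Function.argmin_le (fun n => Nat.card (S.E n)) m)
    intro m hm
    rw [h m ((le_max_right _ _).trans hm), h n (le_max_right _ _)]
  have hn2 : 2 ≤ n := le_max_left _ _
  refine ⟨n, hn2, eq_bot_of_le_commutator_top_sup_powerSubgroup hG ?_⟩
  have h := S.succ_le (n + d) (by omega)
  rwa [hstab _ (by omega), hstab (n + d) (by omega), hstab (max 2 (n + d + 1 - d)) (by omega)] at h

theorem PotentSeries.exists_commutator_eq (hG : IsPGroup p G) {d : ℕ} (S : PotentSeries G p d) :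
    ∃ x : G, ∀ c ∈ commutator G, ∃ g : G, ⁅x, g⁆ = c := by
  classical
  have hp := S.prime.two_le
  have hdp := S.le_pred
  obtain ⟨x, hx⟩ := exists_forall_notMem_of_card_le hG
    ((Finset.Icc 1 (d + 1)).filter fun j => relCentralizer (S.E j) (S.E (j + 2)) ≠ ⊤)
    ((Finset.card_filter_le _ _).trans (by rw [Nat.card_Icc]; omega))
    (fun j => relCentralizer (S.E j) (S.E (j + 2))) (fun j hj => (Finset.mem_filter.1 hj).2)
  obtain ⟨n, hn, hbot⟩ := S.exists_eq_bot hG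
  refine ⟨x, fun c hc => ?_⟩
  obtain ⟨g, hg⟩ := S.exists_mk_commutator_eq (x := x)
    (S.reaches_of_notMem fun j h1 h2 h3 =>
      hx j (Finset.mem_filter.2 ⟨Finset.mem_Icc.2 ⟨h1, h2⟩, h3⟩)) hc n hn
  refine ⟨g, ?_⟩
  have := QuotientGroup.eq.1 hg
  rw [hbot, Subgroup.mem_bot] at this
  exact inv_mul_eq_one.1 this

end PGroup

/-! ### Construction of the series -/

section Construction

variable (G : Type*) [Group G]

/-- The series `E 1 = G`, `E 2 = G'`, `E (j + 1) = [E j, G] (E (max 2 (j + 1 - d))) ^ p`. The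
minimum with the previous index only matters for `d = 0`, where it keeps the recursion
well-founded. -/
def potentSeries (p d : ℕ) : ℕ → Subgroup G
  | 0 => ⊤
  | 1 => ⊤
  | 2 => commutator G
  | j + 3 => ⁅potentSeries p d (j + 2), (⊤ : Subgroup G)⁆ ⊔
      powerSubgroup (potentSeries p d (min (j + 2) (max 2 (j + 3 - d)))) p
termination_by j => j

variable {G} {p d : ℕ}

lemma potentSeries_succ (hd : 1 ≤ d) {j : ℕ} (hj : 2 ≤ j) :
    potentSeries G p d (j + 1) = ⁅potentSeries G p d j, (⊤ : Subgroup G)⁆ ⊔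
      powerSubgroup (potentSeries G p d (max 2 (j + 1 - d))) p := by
  obtain ⟨j, rfl⟩ := Nat.exists_eq_add_of_le' hj
  rw [potentSeries, min_eq_right (by omega)]

lemma powerSubgroup_mono {A B : Subgroup G} (h : A ≤ B) (n : ℕ) :
    powerSubgroup A n ≤ powerSubgroup B n :=
  Subgroup.closure_mono (Set.image_mono h)

lemma powerSubgroup_le (A : Subgroup G) (n : ℕ) : powerSubgroup A n ≤ A := by
  refine (Subgroup.closure_le _).2 ?_
  rintro _ ⟨a, ha, rfl⟩
  exact pow_mem ha n

lemma potentSeries_normal (j : ℕ) : (potentSeries G p d j).Normal := by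
  induction j using Nat.strong_induction_on with
  | _ j ih =>
    match j with
    | 0 => rw [potentSeries]; infer_instance
    | 1 => rw [potentSeries]; infer_instance
    | 2 => rw [potentSeries]; infer_instance
    | j + 3 =>
      rw [potentSeries]
      have := ih (j + 2) (by omega)
      have := ih (min (j + 2) (max 2 (j + 3 - d))) (by omega)
      infer_instance

lemma potentSeries_antitone (hd : 1 ≤ d) : Antitone (potentSeries G p d) := by
  refine antitone_nat_of_succ_le fun j => ?_
  induction j using Nat.strong_induction_on with
  | _ j ih =>
    match j with
    | 0 => rw [potentSeries]; exact le_top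
    | 1 => rw [potentSeries, potentSeries]; exact le_top
    | 2 =>
      have := potentSeries_normal (G := G) (p := p) (d := d) 2
      rw [potentSeries_succ hd le_rfl, show max 2 (2 + 1 - d) = 2 by omega]
      exact sup_le (Subgroup.commutator_le_left _ _) (powerSubgroup_le _ _)
    | j + 3 =>
      have h3 := potentSeries_succ (G := G) (p := p) hd (show 2 ≤ j + 2 by omega)
      rw [potentSeries_succ hd (show 2 ≤ j + 3 by omega)]
      refine le_trans ?_ h3.ge
      refine sup_le_sup (Subgroup.commutator_mono (ih (j + 2) (by omega)) le_rfl)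
        (powerSubgroup_mono ?_ p)
      rcases Nat.lt_or_ge (j + 3) (d + 2) with h | h
      · rw [show max 2 (j + 3 + 1 - d) = max 2 (j + 2 + 1 - d) by omega]
      · rw [show max 2 (j + 3 + 1 - d) = max 2 (j + 2 + 1 - d) + 1 by omega]
        exact ih _ (by omega)

lemma commutator_potentSeries_le (hd : 1 ≤ d) (j : ℕ) :
    ⁅potentSeries G p d j, (⊤ : Subgroup G)⁆ ≤ potentSeries G p d (j + 1) := by
  match j with
  | 0 => rw [potentSeries, potentSeries]; exact le_top
  | 1 => rw [potentSeries, potentSeries]; exact le_rfl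
  | j + 2 => rw [potentSeries_succ hd (show 2 ≤ j + 2 by omega)]; exact le_sup_left

lemma pow_mem_potentSeries (hd : 1 ≤ d) (j : ℕ) (hj : 2 ≤ j) :
    ∀ y ∈ potentSeries G p d j, y ^ p ∈ potentSeries G p d (j + d) := by
  obtain ⟨e, rfl⟩ := Nat.exists_eq_add_of_le' hd
  intro y hy
  rw [← Nat.add_assoc, potentSeries_succ hd (by omega),
    show max 2 (j + e + 1 - (e + 1)) = j by omega]
  exact Subgroup.mem_sup_right (Subgroup.subset_closure ⟨y, hy, rfl⟩)

/-- Modulo `(G') ^ p` the terms from `E 2` to `E (d + 2)` are the subgroups `[G', G, …, G]`. -/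
lemma map_potentSeries (hd : 1 ≤ d) (i : ℕ) (hi : i ≤ d) :
    powerSubgroup (commutator G) p ≤ potentSeries G p d (i + 2) ∧
    (potentSeries G p d (i + 2)).map (QuotientGroup.mk' (powerSubgroup (commutator G) p)) =
      iteratedCommutator
        ((commutator G).map (QuotientGroup.mk' (powerSubgroup (commutator G) p))) i := by
  have h2 : potentSeries G p d 2 = commutator G := by rw [potentSeries]
  induction i with
  | zero =>
    rw [h2]
    exact ⟨powerSubgroup_le _ _, rfl⟩
  | succ i ih =>
    rw [show i + 1 + 2 = i + 2 + 1 by omega, potentSeries_succ hd (by omega),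
      show max 2 (i + 2 + 1 - d) = 2 by omega, h2]
    refine ⟨le_sup_right, ?_⟩
    rw [Subgroup.map_sup, Subgroup.map_commutator, (ih (by omega)).2,
      Subgroup.map_top_of_surjective _ (QuotientGroup.mk'_surjective _),
      (Subgroup.map_eq_bot_iff _).2 (QuotientGroup.ker_mk' _).ge, sup_bot_eq]
    rfl

section Finite

variable [Finite G] [Fact p.Prime]

lemma le_relIndex_of_not_le (hG : IsPGroup p G) {A B : Subgroup G} (h : ¬ B ≤ A) :
    p ≤ A.relIndex B := by
  obtain ⟨n, hn⟩ := (hG.to_subgroup B).index (A.subgroupOf B)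
  have hn0 : n ≠ 0 := by
    rintro rfl
    exact h (Subgroup.relIndex_eq_one.1 (by simpa using hn))
  exact (Nat.le_self_pow hn0 p).trans hn.ge

lemma iteratedCommutator_eq_bot (hG : IsPGroup p G) {A : Subgroup G} [A.Normal] {n : ℕ}
    (hA : Nat.card A = p ^ n) : iteratedCommutator A n = ⊥ := by
  have hp : p.Prime := Fact.out
  have hnormal : ∀ i, (iteratedCommutator A i).Normal := by
    intro i
    induction i with
    | zero => assumption
    | succ i ih => exact Subgroup.commutator_normal _ _
  have key : ∀ i, iteratedCommutator A i = ⊥ ∨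
      Nat.card (iteratedCommutator A i) * p ^ i ≤ p ^ n := by
    intro i
    induction i with
    | zero => exact Or.inr (by rw [pow_zero, mul_one]; exact hA.le)
    | succ i ih =>
      rcases ih with h | h
      · exact Or.inl (by rw [iteratedCommutator, h, Subgroup.commutator_bot_left])
      · by_cases hle : iteratedCommutator A i ≤ iteratedCommutator A (i + 1)
        · have h0 := eq_bot_of_le_commutator_top hG hle
          exact Or.inl (by rw [iteratedCommutator, h0, Subgroup.commutator_bot_left])
        · right
          have hn := hnormal i
          have h1 : iteratedCommutator A (i + 1) ≤ iteratedCommutator A i :=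
            Subgroup.commutator_le_left _ _
          have h2 := le_relIndex_of_not_le hG hle
          have h3 := Subgroup.relIndex_mul_relIndex ⊥ _ _ bot_le h1
          rw [Subgroup.relIndex_bot_left, Subgroup.relIndex_bot_left] at h3
          calc _ = Nat.card (iteratedCommutator A (i + 1)) * p * p ^ i := by ring
            _ ≤ _ := (Nat.mul_le_mul_right _ (h3 ▸ Nat.mul_le_mul_left _ h2)).trans h
  rcases key n with h | h
  · exact h
  · refine Subgroup.eq_bot_of_card_le _ ?_
    have : 0 < p ^ n := pow_pos hp.pos n
    nlinarith

lemma exists_potentSeries (hG : IsPGroup p G) (d : ℕ)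
    (hd : (powerSubgroup (commutator G) p).relIndex (commutator G) = p ^ d) (hdp : d ≤ p - 1)
    (huni : IsUniserialActionMod p (commutator G) (powerSubgroup (commutator G) p)) :
    ∃ e, Nonempty (PotentSeries G p e) := by
  have hp : p.Prime := Fact.out
  set R := powerSubgroup (commutator G) p with hR
  set A := (commutator G).map (QuotientGroup.mk' R) with hA
  have hcard : Nat.card A = p ^ d := by
    rw [← hd, hA, ← Subgroup.relIndex_ker, QuotientGroup.ker_mk']
  have hAn : A.Normal := Subgroup.Normal.map inferInstance _ (QuotientGroup.mk'_surjective R)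
  -- For `d = 0` the group `G'` equals `(G') ^ p`, and the value `1` serves as well.
  have h1 : 1 ≤ max d 1 := le_max_right _ _
  have h2 : potentSeries G p (max d 1) 2 = commutator G := by rw [potentSeries]
  have hbot : iteratedCommutator A (max d 1) = ⊥ := by
    have h := iteratedCommutator_eq_bot (hG.to_quotient R) hcard
    rcases Nat.eq_zero_or_pos d with rfl | hpos
    · change ⁅iteratedCommutator A 0, _⁆ = ⊥
      rw [h, Subgroup.commutator_bot_left]
    · rwa [max_eq_left hpos]
  refine ⟨max d 1, ⟨⟨potentSeries G p (max d 1), potentSeries_normal, hp, h1,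
    max_le hdp (by have := hp.two_le; omega), by rw [potentSeries], h2, potentSeries_antitone h1,
    commutator_potentSeries_le h1, pow_mem_potentSeries h1,
    fun j hj => (potentSeries_succ h1 hj).le, ?_, ?_⟩⟩⟩
  · have h := (map_potentSeries (G := G) (p := p) h1 _ le_rfl).2.trans hbot
    rw [Subgroup.map_eq_bot_iff, QuotientGroup.ker_mk'] at h
    rwa [h2]
  · intro j hj hjd u hu hu'
    obtain ⟨i, rfl⟩ := Nat.exists_eq_add_of_le' hj
    have hi := map_potentSeries (G := G) (p := p) h1 i (by omega)
    have hi' := map_potentSeries (G := G) (p := p) h1 (i + 1) (by omega)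
    rw [show i + 1 + 2 = i + 2 + 1 by omega] at hi'
    have hidx : (potentSeries G p (max d 1) (i + 2 + 1)).relIndex
        (potentSeries G p (max d 1) (i + 2)) ≤ p := by
      have h := huni i
      rw [← hi.2, ← hi'.2, ← Subgroup.relIndex_comap, Subgroup.comap_map_eq_self] at h
      · exact h
      · rw [QuotientGroup.ker_mk']
        exact hi'.1
    set B := Subgroup.zpowers u ⊔ potentSeries G p (max d 1) (i + 2 + 1) with hB
    have hBle : B ≤ potentSeries G p (max d 1) (i + 2) :=
      sup_le ((Subgroup.zpowers_le).2 hu) (potentSeries_antitone h1 (Nat.le_succ _))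
    have hmul := Subgroup.relIndex_mul_relIndex _ _ _
      (le_sup_right : potentSeries G p (max d 1) (i + 2 + 1) ≤ B) hBle
    have hBp := le_relIndex_of_not_le hG
      (fun h : B ≤ potentSeries G p (max d 1) (i + 2 + 1) =>
        hu' (h (Subgroup.mem_sup_left (Subgroup.mem_zpowers u))))
    by_contra hcon
    have h3 := le_relIndex_of_not_le hG hcon
    have := hp.two_le
    nlinarith

end Finite

end Construction

theorem theoremB {G : Type*} [Group G] [Finite G] (p : ℕ) [Fact p.Prime] (hG : IsPGroup p G)
    (d : ℕ) (hd : (powerSubgroup (commutator G) p).relIndex (commutator G) = p ^ d)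
    (hdp : d ≤ p - 1)
    (huni : IsUniserialActionMod p (commutator G) (powerSubgroup (commutator G) p)) :
    ∃ x : G, (commutator G : Set G) = {c : G | ∃ g : G, ⁅x, g⁆ = c} := by
  obtain ⟨e, ⟨S⟩⟩ := exists_potentSeries hG d hd hdp huni
  obtain ⟨x, hx⟩ := S.exists_commutator_eq hG
  refine ⟨x, Set.Subset.antisymm hx ?_⟩
  rintro _ ⟨g, rfl⟩
  exact Subgroup.commutator_mem_commutator trivial trivial
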